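/- Let $\Gamma$ be a discrete group. For an algebraic (not necessarily closed) two-sided ideal $D$ of $\ell^\infty(\Gamma)$, call a unitary representation $\pi\colon\Gamma\to\mathbb B(\mathcal H)$ a $D$-representation if there is a dense linear subspace $\mathcal H_0\subset\mathcal H$ such that for all $\xi,\eta\in\mathcal H_0$ the matrix coefficient $s\mapsto\langle\pi_s\xi,\eta\rangle$ belongs to $D$. Extend $\pi$ linearly to the group ring $\mathbb C[\Gamma]$, let $$\|x\|_D=\sup\{\|\pi(x)\| : \pi \text{ is a } D\text{-representation}\}\qquad(x\in\mathbb C[\Gamma]),$$ and let $C^*_D(\Gamma)$ be the C*-algebra obtained as the (Hausdorff) completion of $\mathbb C[\Gamma]$ with respect to $\|\cdot\|_D$. Let $C^*_r(\Gamma)$ be the reduced group C*-algebra, i.e. the norm closure of $\lambda(\mathbb C[\Gamma])$ in $\mathbb B(\ell^2(\Gamma))$, where $\lambda$ is the left regular representation, $(\lambda_sf)(t)=f(s^{-1}t)$. Then for every discrete group $\Gamma$ and every $p\in[1,2]$ the completion with respect to the ideal $D=\ell^p(\Gamma)$ is the reduced group C*-algebra, $C^*_{\ell^p}(\Gamma)=C^*_r(\Gamma)$;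 that is, there is an isometric $*$-isomorphism $C^*_{\ell^p}(\Gamma)\to C^*_r(\Gamma)$ which sends the canonical image of each $x\in\mathbb C[\Gamma]$ to $\lambda(x)$. -/

import Mathlib

open scoped ENNReal lp

noncomputable section

namespace IdealCompletions

universe u

section GroupRing

variable {Γ : Type u} [Group Γ]

/-- The standard involution on the complex group ring: `(∑ a_g g)^* = ∑ conj(a_g) g⁻¹`. -/
instance groupRingStar : Star (MonoidAlgebra ℂ Γ) where
  star x := MonoidAlgebra.ofCoeff
    ((x.coeff.mapRange star (star_zero ℂ)).equivMapDomain (Equiv.inv Γ))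

theorem coeff_star (x : MonoidAlgebra ℂ Γ) (g : Γ) :
    (star x).coeff g = star (x.coeff g⁻¹) := by
  simp [star]

theorem star_single (g : Γ) (a : ℂ) :
    star (MonoidAlgebra.single g a) = MonoidAlgebra.single g⁻¹ (star a) := by
  simp [star]

theorem star_add_aux (x y : MonoidAlgebra ℂ Γ) : star (x + y) = star x + star y := by
  ext g
  simp [coeff_star]

instance groupRingStarRing : StarRing (MonoidAlgebra ℂ Γ) where
  star_involutive x := by
    ext g
    simp [coeff_star]
  star_add := star_add_aux
  star_mul x y := by
    induction x using MonoidAlgebra.induction_linear with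
    | zero =>
      have h : star (0 : MonoidAlgebra ℂ Γ) = 0 := by ext g; simp [coeff_star]
      simp [h]
    | add x₁ x₂ h₁ h₂ => rw [add_mul, star_add_aux, h₁, h₂, star_add_aux, mul_add]
    | single g a =>
      induction y using MonoidAlgebra.induction_linear with
      | zero =>
        have h : star (0 : MonoidAlgebra ℂ Γ) = 0 := by ext g; simp [coeff_star]
        simp [h]
      | add y₁ y₂ h₁ h₂ => rw [mul_add, star_add_aux, h₁, h₂, star_add_aux, add_mul]
      | single h b => simp [star_single, MonoidAlgebra.single_mul_single, mul_comm]

instance groupRingStarModule : StarModule ℂ (MonoidAlgebra ℂ Γ) where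
  star_smul c x := by
    ext g
    simp [coeff_star]

end GroupRing

section Representations

variable {Γ : Type u} [Group Γ]
variable {H : Type*} [NormedAddCommGroup H] [InnerProductSpace ℂ H] [CompleteSpace H]

/-- The `*`-homomorphism `ℂ[Γ] → B(H)` extending a unitary representation `π` of `Γ` linearly. -/
def integratedForm (π : Γ →* unitary (H →L[ℂ] H)) :
    MonoidAlgebra ℂ Γ →⋆ₐ[ℂ] (H →L[ℂ] H) where
  toAlgHom := MonoidAlgebra.lift ℂ (H →L[ℂ] H) Γ ((unitary (H →L[ℂ] H)).subtype.comp π)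
  map_star' x := by
    induction x using MonoidAlgebra.induction_linear with
    | zero => simp
    | add x y hx hy =>
      simp only [AlgHom.toRingHom_eq_coe, RingHom.toMonoidHom_eq_coe, OneHom.toFun_eq_coe,
        MonoidHom.toOneHom_coe, MonoidHom.coe_coe, RingHom.coe_coe, star_add, map_add] at hx hy ⊢
      rw [hx, hy]
    | single g a =>
      simp only [AlgHom.toRingHom_eq_coe, RingHom.toMonoidHom_eq_coe, OneHom.toFun_eq_coe,
        MonoidHom.toOneHom_coe, MonoidHom.coe_coe, RingHom.coe_coe, star_single,
        MonoidAlgebra.lift_single, MonoidHom.comp_apply, star_smul, map_inv]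
      rfl

theorem integratedForm_single (π : Γ →* unitary (H →L[ℂ] H)) (g : Γ) (a : ℂ) :
    integratedForm π (MonoidAlgebra.single g a) = a • (π g : H →L[ℂ] H) :=
  MonoidAlgebra.lift_single _ _ _

/-- The matrix coefficient `π_{ξ,η}(s) = ⟨π_s ξ, η⟩`, linear in `ξ` and conjugate linear in `η`,
as an element of `ℓ^∞(Γ)`. (Mathlib's inner product is conjugate linear in its first argument.) -/
def matrixCoeff (π : Γ →* unitary (H →L[ℂ] H)) (ξ η : H) : ℓ^∞(Γ, ℂ) :=
  ⟨fun s => inner ℂ η ((π s : H →L[ℂ] H) ξ), memℓp_infty ⟨‖η‖ * ‖ξ‖, by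
    rintro _ ⟨s, rfl⟩
    refine (norm_inner_le_norm _ _).trans ?_
    rw [Unitary.norm_map]⟩⟩

/-- A unitary representation is a `D`-representation if its matrix coefficients with respect to
the vectors of some dense linear subspace all belong to `D`. -/
def IsDRepresentation (D : Ideal ℓ^∞(Γ, ℂ)) (π : Γ →* unitary (H →L[ℂ] H)) : Prop :=
  ∃ H₀ : Submodule ℂ H, Dense (H₀ : Set H) ∧ ∀ ξ ∈ H₀, ∀ η ∈ H₀, matrixCoeff π ξ η ∈ D

end Representations

section Completion

variable {Γ : Type u} [Group Γ]

/-- The set of the numbers `‖π(x)‖`, where `π` runs over the `D`-representations of `Γ`.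
Hilbert spaces in the universe of `Γ` suffice: given a `D`-representation on any Hilbert space and
`x`, one finds a closed invariant subspace of density character at most `max |Γ| ℵ₀` that is again
a `D`-representation and on which `π(x)` has the same norm. -/
def dNormSet (D : Ideal ℓ^∞(Γ, ℂ)) (x : MonoidAlgebra ℂ Γ) : Set ℝ :=
  {r | ∃ (H : Type u) (_ : NormedAddCommGroup H) (_ : InnerProductSpace ℂ H)
      (_ : CompleteSpace H) (π : Γ →* unitary (H →L[ℂ] H)),
      IsDRepresentation D π ∧ r = ‖integratedForm π x‖}

/-- `‖x‖_D = sup { ‖π(x)‖ : π is a D-representation }`. -/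
def dNorm (D : Ideal ℓ^∞(Γ, ℂ)) (x : MonoidAlgebra ℂ Γ) : ℝ := sSup (dNormSet D x)

/-- The supremum is over a bounded set. -/
theorem dNormSet_bddAbove (D : Ideal ℓ^∞(Γ, ℂ)) (x : MonoidAlgebra ℂ Γ) :
    BddAbove (dNormSet D x) := by
  induction x using MonoidAlgebra.induction_linear with
  | zero =>
    refine ⟨0, ?_⟩
    rintro r ⟨H, _, _, _, π, -, rfl⟩
    simp
  | add x y hx hy =>
    obtain ⟨a, ha⟩ := hx
    obtain ⟨b, hb⟩ := hy
    refine ⟨a + b, ?_⟩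
    rintro r ⟨H, i₁, i₂, i₃, π, hπ, rfl⟩
    rw [map_add]
    exact (norm_add_le _ _).trans
      (add_le_add (ha ⟨H, i₁, i₂, i₃, π, hπ, rfl⟩) (hb ⟨H, i₁, i₂, i₃, π, hπ, rfl⟩))
  | single g a =>
    refine ⟨‖a‖, ?_⟩
    rintro r ⟨H, _, _, _, π, -, rfl⟩
    rw [integratedForm_single, norm_smul]
    refine mul_le_of_le_one_right (norm_nonneg a) ?_
    refine ContinuousLinearMap.opNorm_le_bound _ zero_le_one fun v => ?_
    rw [Unitary.norm_map, one_mul]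

/-- The supremum is over a nonempty set: the zero representation is a `D`-representation. -/
theorem dNormSet_nonempty (D : Ideal ℓ^∞(Γ, ℂ)) (x : MonoidAlgebra ℂ Γ) :
    (dNormSet D x).Nonempty := by
  refine ⟨_, EuclideanSpace ℂ PEmpty.{u + 1}, inferInstance, inferInstance, inferInstance, 1,
    ⟨⊤, by simp, fun ξ _ η _ => ?_⟩, rfl⟩
  have : matrixCoeff (1 : Γ →* unitary
      (EuclideanSpace ℂ PEmpty.{u + 1} →L[ℂ] EuclideanSpace ℂ PEmpty.{u + 1})) ξ η = 0 := by
    ext s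
    have : η = 0 := Subsingleton.elim _ _
    simp [matrixCoeff, this]
  rw [this]
  exact D.zero_mem

theorem norm_integratedForm_le_dNorm (D : Ideal ℓ^∞(Γ, ℂ)) {H : Type u} [NormedAddCommGroup H]
    [InnerProductSpace ℂ H] [CompleteSpace H] (π : Γ →* unitary (H →L[ℂ] H))
    (hπ : IsDRepresentation D π) (x : MonoidAlgebra ℂ Γ) :
    ‖integratedForm π x‖ ≤ dNorm D x :=
  le_csSup (dNormSet_bddAbove D x) ⟨H, _, _, _, π, hπ, rfl⟩

theorem dNorm_nonneg (D : Ideal ℓ^∞(Γ, ℂ)) (x : MonoidAlgebra ℂ Γ) : 0 ≤ dNorm D x := by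
  refine Real.sSup_nonneg ?_
  rintro r ⟨H, _, _, _, π, -, rfl⟩
  exact norm_nonneg _

theorem dNorm_le (D : Ideal ℓ^∞(Γ, ℂ)) (x : MonoidAlgebra ℂ Γ) (c : ℝ)
    (h : ∀ (H : Type u) [NormedAddCommGroup H] [InnerProductSpace ℂ H] [CompleteSpace H]
      (π : Γ →* unitary (H →L[ℂ] H)), IsDRepresentation D π → ‖integratedForm π x‖ ≤ c) :
    dNorm D x ≤ c := by
  refine csSup_le (dNormSet_nonempty D x) ?_
  rintro r ⟨H, _, _, _, π, hπ, rfl⟩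
  exact h H π hπ

/-- `‖·‖_D` as a submultiplicative seminorm on the group ring. -/
def dRingSeminorm (D : Ideal ℓ^∞(Γ, ℂ)) : RingSeminorm (MonoidAlgebra ℂ Γ) where
  toFun := dNorm D
  map_zero' := le_antisymm (dNorm_le D _ _ fun H _ _ _ π _ => by simp) (dNorm_nonneg D _)
  add_le' x y := dNorm_le D _ _ fun H _ _ _ π hπ => by
    rw [map_add]
    exact (norm_add_le _ _).trans (add_le_add (norm_integratedForm_le_dNorm D π hπ x)
      (norm_integratedForm_le_dNorm D π hπ y))
  neg' x := by
    refine le_antisymm (dNorm_le D _ _ fun H _ _ _ π hπ => ?_)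
      (dNorm_le D _ _ fun H _ _ _ π hπ => ?_)
    · rw [map_neg, norm_neg]
      exact norm_integratedForm_le_dNorm D π hπ x
    · rw [← norm_neg, ← map_neg]
      exact norm_integratedForm_le_dNorm D π hπ (-x)
  mul_le' x y := dNorm_le D _ _ fun H _ _ _ π hπ => by
    rw [map_mul]
    exact (norm_mul_le _ _).trans (mul_le_mul (norm_integratedForm_le_dNorm D π hπ x)
      (norm_integratedForm_le_dNorm D π hπ y) (norm_nonneg _) (dNorm_nonneg D x))

theorem dNorm_smul_le (D : Ideal ℓ^∞(Γ, ℂ)) (c : ℂ) (x : MonoidAlgebra ℂ Γ) :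
    dNorm D (c • x) ≤ ‖c‖ * dNorm D x :=
  dNorm_le D _ _ fun H _ _ _ π hπ => by
    rw [map_smul, norm_smul]
    exact mul_le_mul_of_nonneg_left (norm_integratedForm_le_dNorm D π hπ x) (norm_nonneg c)

theorem dNorm_star_le (D : Ideal ℓ^∞(Γ, ℂ)) (x : MonoidAlgebra ℂ Γ) :
    dNorm D (star x) ≤ dNorm D x :=
  dNorm_le D _ _ fun H _ _ _ π hπ => by
    rw [map_star, norm_star]
    exact norm_integratedForm_le_dNorm D π hπ x

theorem dNorm_star (D : Ideal ℓ^∞(Γ, ℂ)) (x : MonoidAlgebra ℂ Γ) :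
    dNorm D (star x) = dNorm D x :=
  le_antisymm (dNorm_star_le D x) (by simpa using dNorm_star_le D (star x))

theorem dNorm_mul_self_le (D : Ideal ℓ^∞(Γ, ℂ)) (x : MonoidAlgebra ℂ Γ) :
    dNorm D x * dNorm D x ≤ dNorm D (star x * x) := by
  have h : dNorm D x ≤ √(dNorm D (star x * x)) := dNorm_le D _ _ fun H _ _ _ π hπ => by
    refine Real.le_sqrt_of_sq_le ?_
    rw [pow_two, ← CStarRing.norm_star_mul_self, ← map_star, ← map_mul]
    exact norm_integratedForm_le_dNorm D π hπ _
  calc dNorm D x * dNorm D x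
      ≤ √(dNorm D (star x * x)) * √(dNorm D (star x * x)) :=
        mul_le_mul h h (dNorm_nonneg D x) (Real.sqrt_nonneg _)
    _ = dNorm D (star x * x) := Real.mul_self_sqrt (dNorm_nonneg D _)

/-- The group ring `ℂ[Γ]`, carrying the seminorm `‖·‖_D`. -/
def DGroupRing (_D : Ideal ℓ^∞(Γ, ℂ)) : Type u := MonoidAlgebra ℂ Γ

variable (D : Ideal ℓ^∞(Γ, ℂ))

instance : Ring (DGroupRing D) := inferInstanceAs (Ring (MonoidAlgebra ℂ Γ))

instance : Algebra ℂ (DGroupRing D) := inferInstanceAs (Algebra ℂ (MonoidAlgebra ℂ Γ))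

instance : StarRing (DGroupRing D) := inferInstanceAs (StarRing (MonoidAlgebra ℂ Γ))

instance : StarModule ℂ (DGroupRing D) := inferInstanceAs (StarModule ℂ (MonoidAlgebra ℂ Γ))

/-- The identity map from the group ring to the group ring with the seminorm `‖·‖_D`. -/
def toDGroupRing : MonoidAlgebra ℂ Γ ≃⋆ₐ[ℂ] DGroupRing D :=
  StarAlgEquiv.refl (R := ℂ) (A := MonoidAlgebra ℂ Γ)

instance : SeminormedRing (DGroupRing D) :=
  RingSeminorm.toSeminormedRing (R := DGroupRing D) (dRingSeminorm D)

theorem norm_toDGroupRing (x : MonoidAlgebra ℂ Γ) : ‖toDGroupRing D x‖ = dNorm D x := rfl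

instance : NormedAlgebra ℂ (DGroupRing D) where
  norm_smul_le c x := dNorm_smul_le D c x

instance : NormedStarGroup (DGroupRing D) where
  norm_star_le x := dNorm_star_le D x

theorem norm_mul_self_le_dGroupRing (x : DGroupRing D) : ‖x‖ * ‖x‖ ≤ ‖star x * x‖ :=
  dNorm_mul_self_le D x

/-- The ideal completion `C*_D(Γ)`: the (Hausdorff) completion of the group ring with respect to
`‖·‖_D`. -/
def IdealCompletion : Type u := UniformSpace.Completion (DGroupRing D)

instance : NormedRing (IdealCompletion D) :=
  inferInstanceAs (NormedRing (UniformSpace.Completion (DGroupRing D)))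

instance : CompleteSpace (IdealCompletion D) :=
  inferInstanceAs (CompleteSpace (UniformSpace.Completion (DGroupRing D)))

instance : Algebra ℂ (IdealCompletion D) :=
  inferInstanceAs (Algebra ℂ (UniformSpace.Completion (DGroupRing D)))

/-- The involution of `C*_D(Γ)` is the continuous extension of that of the group ring. -/
instance : Star (IdealCompletion D) where
  star := UniformSpace.Completion.map (star : DGroupRing D → DGroupRing D)

theorem idealCompletion_continuous_star :
    Continuous (star : IdealCompletion D → IdealCompletion D) :=
  UniformSpace.Completion.continuous_map

/-- The canonical map from the group ring to `C*_D(Γ)`, as a bare function. -/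
def coeIdealCompletion (x : DGroupRing D) : IdealCompletion D :=
  (x : UniformSpace.Completion (DGroupRing D))

theorem coeIdealCompletion_mul (x y : DGroupRing D) :
    coeIdealCompletion D (x * y) = coeIdealCompletion D x * coeIdealCompletion D y :=
  UniformSpace.Completion.coe_mul x y

theorem coeIdealCompletion_add (x y : DGroupRing D) :
    coeIdealCompletion D (x + y) = coeIdealCompletion D x + coeIdealCompletion D y :=
  UniformSpace.Completion.coe_add x y

theorem coeIdealCompletion_smul (c : ℂ) (x : DGroupRing D) :
    coeIdealCompletion D (c • x) = c • coeIdealCompletion D x := by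
  rw [Algebra.smul_def, Algebra.smul_def, coeIdealCompletion_mul]
  rfl

theorem coeIdealCompletion_star (x : DGroupRing D) :
    coeIdealCompletion D (star x) = star (coeIdealCompletion D x) :=
  (UniformSpace.Completion.map_coe (star_isometry (E := DGroupRing D)).uniformContinuous x).symm

theorem norm_coeIdealCompletion (x : DGroupRing D) : ‖coeIdealCompletion D x‖ = ‖x‖ :=
  UniformSpace.Completion.norm_coe x

theorem idealCompletion_induction {p : IdealCompletion D → Prop} (hp : IsClosed {a | p a})
    (h : ∀ x, p (coeIdealCompletion D x)) (a : IdealCompletion D) : p a :=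
  UniformSpace.Completion.induction_on a hp h

theorem idealCompletion_induction₂ {p : IdealCompletion D → IdealCompletion D → Prop}
    (hp : IsClosed {a : IdealCompletion D × IdealCompletion D | p a.1 a.2})
    (h : ∀ x y, p (coeIdealCompletion D x) (coeIdealCompletion D y))
    (a b : IdealCompletion D) : p a b :=
  UniformSpace.Completion.induction_on₂ a b hp h

/-- `C*_D(Γ)` is a unital C*-algebra. -/
instance : CStarAlgebra (IdealCompletion D) where
  __ := (inferInstance : NormedRing (IdealCompletion D))
  __ := (inferInstance : CompleteSpace (IdealCompletion D))
  __ := (inferInstance : Algebra ℂ (IdealCompletion D))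
  star_involutive a := by
    have hc := idealCompletion_continuous_star D
    induction a using idealCompletion_induction with
    | hp => exact isClosed_eq (hc.comp hc) continuous_id
    | h x => rw [← coeIdealCompletion_star, ← coeIdealCompletion_star, star_star]
  star_mul a b := by
    have hc := idealCompletion_continuous_star D
    induction a, b using idealCompletion_induction₂ with
    | hp =>
      exact isClosed_eq (hc.comp (continuous_fst.mul continuous_snd))
        ((hc.comp continuous_snd).mul (hc.comp continuous_fst))
    | h x y =>
      simp only [← coeIdealCompletion_star, ← coeIdealCompletion_mul, star_mul]
  star_add a b := by
    have hc := idealCompletion_continuous_star D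
    induction a, b using idealCompletion_induction₂ with
    | hp =>
      exact isClosed_eq (hc.comp (continuous_fst.add continuous_snd))
        ((hc.comp continuous_fst).add (hc.comp continuous_snd))
    | h x y =>
      simp only [← coeIdealCompletion_star, ← coeIdealCompletion_add, star_add]
  norm_mul_self_le a := by
    have hc := idealCompletion_continuous_star D
    induction a using idealCompletion_induction with
    | hp =>
      exact isClosed_le (continuous_norm.mul continuous_norm)
        (continuous_norm.comp (hc.mul continuous_id))
    | h x =>
      simp only [← coeIdealCompletion_star, ← coeIdealCompletion_mul, norm_coeIdealCompletion]
      exact norm_mul_self_le_dGroupRing D x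
  norm_smul_le c a :=
    norm_smul_le c (show UniformSpace.Completion (DGroupRing D) from a)
  star_smul c a := by
    have hc := idealCompletion_continuous_star D
    have hs : Continuous fun a : IdealCompletion D => c • a :=
      continuous_const_smul (T := UniformSpace.Completion (DGroupRing D)) c
    have hs' : Continuous fun a : IdealCompletion D => star c • a :=
      continuous_const_smul (T := UniformSpace.Completion (DGroupRing D)) (star c)
    induction a using idealCompletion_induction with
    | hp => exact isClosed_eq (hc.comp hs) (hs'.comp hc)
    | h x =>
      simp only [← coeIdealCompletion_star, ← coeIdealCompletion_smul, star_smul]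

/-- The canonical `*`-homomorphism `ℂ[Γ] → C*_D(Γ)`. It has dense range, and it is injective if and
only if `‖·‖_D` is a norm. -/
def toIdealCompletion : MonoidAlgebra ℂ Γ →⋆ₐ[ℂ] IdealCompletion D where
  toFun x := coeIdealCompletion D (toDGroupRing D x)
  map_one' := UniformSpace.Completion.coe_one (DGroupRing D)
  map_mul' x y := by rw [map_mul, coeIdealCompletion_mul]
  map_zero' := UniformSpace.Completion.coe_zero
  map_add' x y := by rw [map_add, coeIdealCompletion_add]
  commutes' c := rfl
  map_star' x := by rw [map_star, coeIdealCompletion_star]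

theorem norm_toIdealCompletion (x : MonoidAlgebra ℂ Γ) :
    ‖toIdealCompletion D x‖ = dNorm D x :=
  (norm_coeIdealCompletion D _).trans (norm_toDGroupRing D x)

theorem denseRange_toIdealCompletion : DenseRange (toIdealCompletion D) :=
  UniformSpace.Completion.denseRange_coe (α := DGroupRing D)

end Completion

section LpIdeal

/-- `ℓ^p(Γ)` as an ideal of `ℓ^∞(Γ)`: the bounded functions whose `p`-norm is finite. (For `p ≥ 1`
every function of finite `p`-norm is bounded.) -/
def lpIdeal (Γ : Type u) (p : ℝ≥0∞) : Ideal ℓ^∞(Γ, ℂ) where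
  carrier := {f | Memℓp (f : ∀ _ : Γ, ℂ) p}
  zero_mem' := zero_memℓp
  add_mem' hf hg := hf.add hg
  smul_mem' c f hf := by
    have h : Memℓp ((‖c‖ : ℂ) • (f : ∀ _ : Γ, ℂ)) p := Memℓp.const_smul hf _
    refine Memℓp.mono' (g := (‖c‖ : ℂ) • (f : ∀ _ : Γ, ℂ)) h fun s => ?_
    have hc : ‖c s‖ ≤ ‖c‖ := lp.norm_apply_le_norm (by simp) c s
    simpa using mul_le_mul_of_nonneg_right hc (norm_nonneg (f s))

theorem mem_lpIdeal {Γ : Type u} {p : ℝ≥0∞} {f : ℓ^∞(Γ, ℂ)} :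
    f ∈ lpIdeal Γ p ↔ Memℓp (f : ∀ _ : Γ, ℂ) p := Iff.rfl

end LpIdeal

section Reduced

variable (Γ : Type u) [Group Γ]

variable {Γ} in
theorem memℓp_translate (s : Γ) (f : ℓ²(Γ, ℂ)) :
    Memℓp (fun t : Γ => f (s⁻¹ * t)) 2 := by
  have hf := (memℓp_gen_iff (by norm_num)).1 (lp.memℓp f)
  exact memℓp_gen ((Equiv.mulLeft s⁻¹).summable_iff.2 hf)

variable {Γ} in
/-- Left translation on `ℓ²(Γ)`: `(λ_s f)(t) = f(s⁻¹ t)`. -/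
def translate (s : Γ) : ℓ²(Γ, ℂ) ≃ₗᵢ[ℂ] ℓ²(Γ, ℂ) where
  toFun f := ⟨fun t => f (s⁻¹ * t), memℓp_translate s f⟩
  invFun f := ⟨fun t => f (s * t), by
    have h := memℓp_translate s⁻¹ f
    rw [inv_inv] at h
    exact h⟩
  map_add' f g := by ext t; rfl
  map_smul' c f := by ext t; rfl
  left_inv f := by ext t; simp
  right_inv f := by ext t; simp
  norm_map' f := by
    simp only [lp.norm_eq_tsum_rpow (show 0 < (2 : ℝ≥0∞).toReal by norm_num)]
    congr 1
    exact (Equiv.mulLeft s⁻¹).tsum_eq (fun t => ‖f t‖ ^ (2 : ℝ≥0∞).toReal)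

/-- The left regular representation of `Γ` on `ℓ²(Γ)`. -/
def leftRegular : Γ →* unitary (ℓ²(Γ, ℂ) →L[ℂ] ℓ²(Γ, ℂ)) :=
  Unitary.linearIsometryEquiv.symm.toMonoidHom.comp
    { toFun := translate
      map_one' := by
        ext f t
        simp [translate]
      map_mul' := fun s s' => by
        ext f t
        simp [translate, mul_assoc] }

variable {Γ} in
theorem leftRegular_apply (s t : Γ) (f : ℓ²(Γ, ℂ)) :
    (leftRegular Γ s : ℓ²(Γ, ℂ) →L[ℂ] ℓ²(Γ, ℂ)) f t = f (s⁻¹ * t) := rfl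

/-- The reduced group C*-algebra `C*_r(Γ)`: the norm closure in `B(ℓ²(Γ))` of the image of the group
ring under the left regular representation. -/
def reducedGroupCStarAlgebra : StarSubalgebra ℂ (ℓ²(Γ, ℂ) →L[ℂ] ℓ²(Γ, ℂ)) :=
  (integratedForm (leftRegular Γ)).range.topologicalClosure

instance : CStarAlgebra (reducedGroupCStarAlgebra Γ) :=
  StarSubalgebra.cstarAlgebra _ (h_closed := StarSubalgebra.isClosed_topologicalClosure _)

/-- The canonical `*`-homomorphism `ℂ[Γ] → C*_r(Γ)`, `x ↦ λ(x)`. -/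
def toReduced : MonoidAlgebra ℂ Γ →⋆ₐ[ℂ] reducedGroupCStarAlgebra Γ :=
  (integratedForm (leftRegular Γ)).codRestrict _ fun x =>
    StarSubalgebra.le_topologicalClosure _ ⟨x, rfl⟩

theorem coe_toReduced (x : MonoidAlgebra ℂ Γ) :
    (toReduced Γ x : ℓ²(Γ, ℂ) →L[ℂ] ℓ²(Γ, ℂ)) = integratedForm (leftRegular Γ) x := rfl

end Reduced

end IdealCompletions

end

namespace IdealCompletions

open Filter Topology

universe v

/-! It suffices to show `‖x‖_D = ‖λ(x)‖` on `ℂ[Γ]`: both C*-algebras are then completions of the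
group ring for the same seminorm.

The bound `‖λ(x)‖ ≤ ‖x‖_D` holds because `λ` is itself a `D`-representation: finitely supported
vectors are dense and have finitely supported coefficients. For the converse, let `ξ` be a unit
vector in the dense subspace of a `D`-representation `π`. As `p ≤ 2`, its diagonal coefficient lies
in `ℓ²(Γ)`, so `⟨π(y)ξ, ξ⟩ = ⟨λ(y)δ_e, g⟩` for one fixed `g` and all `y` in the group ring
(`exists_inner_eq_inner_leftRegular`). With `a = x* x`, iterating Cauchy–Schwarz gives `|⟨π(a)ξ,
ξ⟩|^(2^k) ≤ |⟨π(a^(2^k))ξ, ξ⟩| ≤ ‖g‖ ‖δ_e‖ ‖λ(a)‖^(2^k)`. Taking `2^k`-th roots removes the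
constant, hence `‖π(x)ξ‖² ≤ ‖λ(a)‖ = ‖λ(x)‖²`, and density of such vectors up to scaling finishes
the bound. -/

/-- If the powers `t ^ 2 ^ k` grow at most like `M ^ 2 ^ k` up to a constant, then `t ≤ M`. -/
theorem le_of_pow_two_pow_le_mul {t M K : ℝ} (hM : 0 ≤ M)
    (h : ∀ k : ℕ, t ^ 2 ^ k ≤ K * M ^ 2 ^ k) : t ≤ M := by
  by_contra! hlt
  have ht : 0 < t := hM.trans_lt hlt
  rcases hM.eq_or_lt with rfl | hM
  -- For `M = 0` the exponent `2 ^ 0 = 1` already gives `t ≤ 0`.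
  · have := h 0
    simp at this
    linarith
  have hr : 1 < t / M := (one_lt_div hM).2 hlt
  obtain ⟨n, hn⟩ := pow_unbounded_of_one_lt K hr
  have h₁ : (t / M) ^ 2 ^ n ≤ K := by
    rw [div_pow, div_le_iff₀ (pow_pos hM _)]
    exact h n
  exact absurd (hn.trans_le (pow_le_pow_right₀ hr.le Nat.lt_two_pow_self.le)) (not_lt.2 h₁)

/-! ### Powers of self-adjoint operators -/

section Hilbert

variable {H : Type*} [NormedAddCommGroup H] [InnerProductSpace ℂ H] [CompleteSpace H]

/-- Iterated Cauchy–Schwarz inequality for a self-adjoint operator. -/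
theorem norm_inner_pow_two_pow_le {A : H →L[ℂ] H} (hA : IsSelfAdjoint A) {ξ : H} (hξ : ‖ξ‖ = 1)
    (k : ℕ) : ‖inner ℂ ξ (A ξ)‖ ^ 2 ^ k ≤ ‖inner ℂ ξ ((A ^ 2 ^ k) ξ)‖ := by
  induction k with
  | zero => simp
  | succ k ih =>
    have hB : IsSelfAdjoint (A ^ 2 ^ k) := hA.pow _
    set B := A ^ 2 ^ k
    have h₁ : ‖inner ℂ ξ (B ξ)‖ ≤ ‖B ξ‖ := by
      simpa [hξ] using norm_inner_le_norm (𝕜 := ℂ) ξ (B ξ)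
    -- Self-adjointness moves one factor across, so squaring the operator turns the bound `‖B ξ‖ ^
    -- 2` into a coefficient of `B * B`.
    have h₂ : inner ℂ ξ ((B * B) ξ) = inner ℂ (B ξ) (B ξ) := by
      rw [mul_apply_eq_comp, ← ContinuousLinearMap.adjoint_inner_left,
        ← ContinuousLinearMap.star_eq_adjoint, hB.star_eq]
    calc ‖inner ℂ ξ (A ξ)‖ ^ 2 ^ (k + 1) = (‖inner ℂ ξ (A ξ)‖ ^ 2 ^ k) ^ 2 := by
          rw [← pow_mul, pow_succ]
      _ ≤ ‖B ξ‖ ^ 2 := pow_le_pow_left₀ (by positivity) (ih.trans h₁) 2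
      _ = ‖inner ℂ ξ ((B * B) ξ)‖ := by
          rw [h₂, inner_self_eq_norm_sq_to_K]
          simp
      _ = ‖inner ℂ ξ ((A ^ 2 ^ (k + 1)) ξ)‖ := by rw [← pow_add, ← two_mul, ← pow_succ']

end Hilbert

/-! ### Weak containment in the regular representation -/

section SquareSummable

variable {Γ : Type u} [Group Γ]
variable {H : Type v} [NormedAddCommGroup H] [InnerProductSpace ℂ H] [CompleteSpace H]

/-- The unit vector `δ_e` of `ℓ²(Γ)`. -/
noncomputable def deltaOne (Γ : Type u) [Group Γ] : ℓ²(Γ, ℂ) :=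
  open Classical in lp.single 2 (1 : Γ) (1 : ℂ)

theorem leftRegular_deltaOne (s : Γ) :
    (leftRegular Γ s : ℓ²(Γ, ℂ) →L[ℂ] ℓ²(Γ, ℂ)) (deltaOne Γ) =
      open Classical in lp.single 2 s (1 : ℂ) := by
  classical
  ext t
  rw [leftRegular_apply, deltaOne, lp.single_apply, lp.single_apply, Pi.single_apply,
    Pi.single_apply]
  simp [inv_mul_eq_one, eq_comm]

/-- A square summable diagonal coefficient of `π` is a coefficient of the regular representation
on the group ring. -/
theorem exists_inner_eq_inner_leftRegular (π : Γ →* unitary (H →L[ℂ] H)) {ξ : H}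
    (hξ : Memℓp (matrixCoeff π ξ ξ : ∀ _ : Γ, ℂ) 2) :
    ∃ g : ℓ²(Γ, ℂ), ∀ y : MonoidAlgebra ℂ Γ, inner ℂ ξ (integratedForm π y ξ) =
      inner ℂ g (integratedForm (leftRegular Γ) y (deltaOne Γ)) := by
  classical
  -- The inner product conjugates its first argument, so `g` is the conjugate of the coefficient.
  refine ⟨star ⟨_, hξ⟩, fun y => ?_⟩
  induction y using MonoidAlgebra.induction_linear with
  | zero => simp
  | add y z hy hz =>
    rw [map_add, map_add, add_apply, add_apply,
      inner_add_right, inner_add_right, hy, hz]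
  | single s a =>
    rw [integratedForm_single, integratedForm_single, smul_apply,
      smul_apply, inner_smul_right, inner_smul_right, leftRegular_deltaOne,
      lp.inner_single_right]
    simp [matrixCoeff]

/-- A vector with square summable diagonal coefficient is moved by `π(x)` no more than `‖λ(x)‖`
allows. -/
theorem norm_integratedForm_apply_le (π : Γ →* unitary (H →L[ℂ] H)) {ξ : H} (h₁ : ‖ξ‖ = 1)
    (hξ : Memℓp (matrixCoeff π ξ ξ : ∀ _ : Γ, ℂ) 2) (x : MonoidAlgebra ℂ Γ) :
    ‖integratedForm π x ξ‖ ≤ ‖integratedForm (leftRegular Γ) x‖ := by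
  obtain ⟨g, hg⟩ := exists_inner_eq_inner_leftRegular π hξ
  have hA : IsSelfAdjoint (integratedForm π (star x * x)) :=
    (IsSelfAdjoint.star_mul_self x).map (integratedForm π)
  have hle : ‖inner ℂ ξ (integratedForm π (star x * x) ξ)‖ ≤
      ‖integratedForm (leftRegular Γ) (star x * x)‖ := by
    -- This constant does not depend on `k`, because the same `g` serves every element of the group
    -- ring.
    refine le_of_pow_two_pow_le_mul (K := ‖g‖ * ‖deltaOne Γ‖) (norm_nonneg _) fun k => ?_
    refine (norm_inner_pow_two_pow_le hA h₁ k).trans ?_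
    rw [← map_pow, hg, map_pow]
    calc _ ≤ ‖g‖ * (‖integratedForm (leftRegular Γ) (star x * x) ^ 2 ^ k‖ * ‖deltaOne Γ‖) :=
          (norm_inner_le_norm _ _).trans
            (mul_le_mul_of_nonneg_left (ContinuousLinearMap.le_opNorm _ _) (norm_nonneg g))
      _ ≤ ‖g‖ * (‖integratedForm (leftRegular Γ) (star x * x)‖ ^ 2 ^ k * ‖deltaOne Γ‖) := by
          gcongr
          exact norm_pow_le' _ (by positivity)
      _ = _ := by ring
  -- The C*-identity on the right and the adjoint on the left reduce `hle` to a comparison of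
  -- squares.
  rw [map_mul, map_mul, map_star, map_star, CStarRing.norm_star_mul_self,
    mul_apply_eq_comp, ContinuousLinearMap.star_eq_adjoint,
    ContinuousLinearMap.adjoint_inner_right, inner_self_eq_norm_sq_to_K] at hle
  refine le_of_sq_le_sq ?_ (norm_nonneg _)
  simpa [pow_two] using hle

/-- A representation with densely many square summable coefficients is weakly contained in the
regular representation. -/
theorem norm_integratedForm_le_leftRegular {p : ℝ≥0∞} (hp : p ≤ 2)
    (π : Γ →* unitary (H →L[ℂ] H)) (hπ : IsDRepresentation (lpIdeal Γ p) π)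
    (x : MonoidAlgebra ℂ Γ) :
    ‖integratedForm π x‖ ≤ ‖integratedForm (leftRegular Γ) x‖ := by
  obtain ⟨H₀, hd, hH₀⟩ := hπ
  refine ContinuousLinearMap.opNorm_le_bound _ (norm_nonneg _) fun ξ => ?_
  -- The estimate is a closed condition on `ξ`, so it need only be checked on `H₀`.
  refine hd.induction (P := fun ξ => ‖integratedForm π x ξ‖ ≤
    ‖integratedForm (leftRegular Γ) x‖ * ‖ξ‖) (fun ξ hξ => ?_)
    (isClosed_le (by fun_prop) (by fun_prop)) ξ
  rcases eq_or_ne ξ 0 with rfl | h0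
  · simp
  have hc : ((‖ξ‖ : ℂ)⁻¹ • ξ) ∈ H₀ := H₀.smul_mem _ hξ
  have h := norm_integratedForm_apply_le π (norm_smul_inv_norm h0)
    ((mem_lpIdeal.1 (hH₀ _ hc _ hc)).of_exponent_ge hp) x
  rw [map_smul, norm_smul, norm_inv, RCLike.norm_ofReal, abs_norm,
    inv_mul_le_iff₀ (norm_pos_iff.2 h0)] at h
  rwa [mul_comm]

end SquareSummable

/-! ### The regular representation attains the supremum -/

section Regular

variable (Γ : Type u)

/-- The finitely supported elements of `ℓ²(Γ)`. -/
def finitelySupported : Submodule ℂ ℓ²(Γ, ℂ) where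
  carrier := {f | (Function.support (f : Γ → ℂ)).Finite}
  zero_mem' := Set.finite_empty.subset fun _ h => h rfl
  add_mem' {f g} hf hg := by
    refine (hf.union hg).subset ?_
    rw [lp.coeFn_add]
    exact Function.support_add _ _
  smul_mem' c f hf := by
    refine Set.Finite.subset hf ?_
    rw [lp.coeFn_smul]
    exact Function.support_const_smul_subset _ _

theorem dense_finitelySupported : Dense (finitelySupported Γ : Set ℓ²(Γ, ℂ)) := by
  classical
  intro f
  refine mem_closure_of_tendsto (lp.hasSum_single (by norm_num) f) (Eventually.of_forall fun s => ?_)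
  refine Submodule.sum_mem _ fun i _ => (Set.finite_singleton i).subset fun t ht => ?_
  by_contra h
  exact ht (lp.single_apply_ne _ _ _ h)

variable [Group Γ]

/-- Coefficients of finitely supported vectors are finitely supported, hence in `ℓ^p` for every `p`.
-/
theorem isDRepresentation_leftRegular (p : ℝ≥0∞) :
    IsDRepresentation (lpIdeal Γ p) (leftRegular Γ) := by
  refine ⟨finitelySupported Γ, dense_finitelySupported Γ, fun ξ hξ η hη => ?_⟩
  refine mem_lpIdeal.2 (Memℓp.of_exponent_ge (memℓp_zero ?_) (zero_le : 0 ≤ p))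
  -- A nonzero term `conj(η t) * ξ (s⁻¹ * t)` forces `s = t * r⁻¹` with `t` in the support of `η`
  -- and `r = s⁻¹ * t` in that of `ξ`.
  refine (Set.Finite.image2 (fun t r : Γ => t * r⁻¹) hη hξ).subset fun s hs => ?_
  by_contra hn
  refine hs ?_
  change inner ℂ η ((leftRegular Γ s : ℓ²(Γ, ℂ) →L[ℂ] ℓ²(Γ, ℂ)) ξ) = 0
  rw [lp.inner_eq_tsum]
  refine (tsum_congr fun t => ?_).trans tsum_zero
  rw [leftRegular_apply]
  by_cases h₁ : η t = 0
  · simp [h₁]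
  by_cases h₂ : ξ (s⁻¹ * t) = 0
  · simp [h₂]
  exact absurd ⟨t, h₁, s⁻¹ * t, h₂, by simp⟩ hn

variable {Γ}

theorem dNorm_lpIdeal {p : ℝ≥0∞} (hp : p ≤ 2) (x : MonoidAlgebra ℂ Γ) :
    dNorm (lpIdeal Γ p) x = ‖integratedForm (leftRegular Γ) x‖ :=
  le_antisymm (dNorm_le _ _ _ fun _ _ _ _ π hπ => norm_integratedForm_le_leftRegular hp π hπ x)
    (norm_integratedForm_le_dNorm _ _ (isDRepresentation_leftRegular Γ p) x)

variable (Γ) in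
theorem denseRange_toReduced : DenseRange (toReduced Γ) := by
  rintro ⟨a, ha⟩
  rw [closure_subtype]
  refine closure_mono ?_ ha
  rintro _ ⟨x, rfl⟩
  exact ⟨toReduced Γ x, ⟨x, rfl⟩, rfl⟩

end Regular

/-! ### From equality of seminorms to an isomorphism -/

section Extension

variable {Γ : Type u} [Group Γ] {D : Ideal ℓ^∞(Γ, ℂ)} {B : Type v} [CStarAlgebra B]

/-- A `*`-homomorphism with dense range that realizes the norm `‖·‖_D` identifies its target with
the ideal completion. -/
theorem exists_starAlgEquiv_idealCompletion (ψ : MonoidAlgebra ℂ Γ →⋆ₐ[ℂ] B)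
    (hψ : ∀ x, ‖ψ x‖ = dNorm D x) (hd : DenseRange ψ) :
    ∃ φ : IdealCompletion D ≃⋆ₐ[ℂ] B, Isometry φ ∧ ∀ x, φ (toIdealCompletion D x) = ψ x := by
  let ψ' : DGroupRing D →⋆ₐ[ℂ] B := ψ.comp (toDGroupRing D).symm
  -- The source carries only a seminorm, so `ψ'` may have a kernel; its extension to the Hausdorff
  -- completion is injective.
  have hψ' : Isometry ψ' := AddMonoidHomClass.isometry_of_norm ψ' fun x => hψ x
  let F : IdealCompletion D → B := UniformSpace.Completion.extension ψ'
  have hF : Isometry F := hψ'.completion_extension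
  have hc : Continuous F := hF.continuous
  have hco (x : DGroupRing D) : F (coeIdealCompletion D x) = ψ' x :=
    UniformSpace.Completion.extension_coe hψ'.uniformContinuous x
  have hmul (a b : IdealCompletion D) : F (a * b) = F a * F b := by
    induction a, b using idealCompletion_induction₂ with
    | hp =>
      exact isClosed_eq (hc.comp (continuous_fst.mul continuous_snd))
        ((hc.comp continuous_fst).mul (hc.comp continuous_snd))
    | h x y => rw [← coeIdealCompletion_mul, hco, hco, hco, map_mul]
  have hadd (a b : IdealCompletion D) : F (a + b) = F a + F b := by
    induction a, b using idealCompletion_induction₂ with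
    | hp =>
      exact isClosed_eq (hc.comp (continuous_fst.add continuous_snd))
        ((hc.comp continuous_fst).add (hc.comp continuous_snd))
    | h x y => rw [← coeIdealCompletion_add, hco, hco, hco, map_add]
  have hstar (a : IdealCompletion D) : F (star a) = star (F a) := by
    induction a using idealCompletion_induction with
    | hp =>
      exact isClosed_eq (hc.comp (idealCompletion_continuous_star D)) (continuous_star.comp hc)
    | h x => rw [← coeIdealCompletion_star, hco, hco, map_star]
  let Φ : IdealCompletion D →⋆ₐ[ℂ] B :=
    { toFun := F
      map_one' := (hco 1).trans (map_one ψ')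
      map_zero' := (hco 0).trans (map_zero ψ')
      map_mul' := hmul
      map_add' := hadd
      commutes' := fun c => (hco (algebraMap ℂ _ c)).trans (AlgHomClass.commutes ψ' c)
      map_star' := hstar }
  have hΦ (x : MonoidAlgebra ℂ Γ) : Φ (toIdealCompletion D x) = ψ x := hco (toDGroupRing D x)
  have hsurj : Function.Surjective Φ := by
    have hdr : DenseRange Φ := hd.mono (by
      rintro _ ⟨x, rfl⟩
      exact ⟨_, hΦ x⟩)
    -- An isometric image of a complete space is closed; being dense too, it is everything.
    have hcl : IsClosed (Set.range Φ) := hF.isClosedEmbedding.isClosed_range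
    exact Set.range_eq_univ.1 (hcl.closure_eq ▸ hdr.closure_range)
  exact ⟨StarAlgEquiv.ofBijective Φ ⟨hF.injective, hsurj⟩, hF, hΦ⟩

end Extension

end IdealCompletions

theorem mainTheorem12 {Γ : Type*} [Group Γ] (p : ℝ≥0∞) (hp₁ : 1 ≤ p) (hp₂ : p ≤ 2) :
    ∃ φ : IdealCompletions.IdealCompletion (IdealCompletions.lpIdeal Γ p) ≃⋆ₐ[ℂ]
        IdealCompletions.reducedGroupCStarAlgebra Γ,
      Isometry φ ∧
      ∀ x : MonoidAlgebra ℂ Γ,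
        φ (IdealCompletions.toIdealCompletion (IdealCompletions.lpIdeal Γ p) x) =
          IdealCompletions.toReduced Γ x :=
  IdealCompletions.exists_starAlgEquiv_idealCompletion (IdealCompletions.toReduced Γ)
    (fun x => (IdealCompletions.dNorm_lpIdeal hp₂ x).symm)
    (IdealCompletions.denseRange_toReduced Γ)
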